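/- Let $q>2$ be a prime power, let $m\ge 2$ and $0\le \ell\le m-1$ be integers, and put $n=(q^m-1)/(q-1)$. Let $\lambda$ be a primitive element of $\mathrm{GF}(q)$ and let $\beta$ be a primitive element of $\mathrm{GF}(q^m)$ with $\beta^n=\lambda$. For $0\le i\le q^m-2$ let $\mathrm{wt}_q(i)$ be the sum of the digits of $i$ in base $q$, and put $$T_{(q,m,\ell)}=\{0\le i\le q^m-2:\ \mathrm{wt}_q(i)=1+(q-1)\ell\},\qquad g_{(q,m,\ell)}(x)=\prod_{i\in T_{(q,m,\ell)}}(x-\beta^i).$$ A linear code $\mathcal C\subseteq \mathrm{GF}(q)^n$ is $\lambda$-constacyclic if $(\lambda c_{n-1},c_0,\ldots,c_{n-2})\in\mathcal C$ whenever $(c_0,\ldots,c_{n-1})\in\mathcal C$; its dual $\mathcal C^\perp$ is taken with respect to the standard bilinear form on $\mathrm{GF}(q)^n$. Put $$K_{(q,m,\ell)}=\sum_{h=0}^{m}(-1)^h\binom{m}{h}\binom{(q-1)\ell-hq+m}{1+(q-1)\ell-hq},$$ where a binomial coefficient with a negative lower entry is $0$. Then $g_{(q,m,\ell)}(x)$ has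 coefficients in $\mathrm{GF}(q)$ and divides $x^n-\lambda$, and $$\{j=1+(q-1)i:\ 0\le i\le n-1,\ g_{(q,m,\ell)}(\beta^j)=0\}=T_{(q,m,\ell)}.$$ Let $\mathcal C_{(q,m,\ell)}\subseteq \mathrm{GF}(q)^n$ be the code with generator polynomial $g_{(q,m,\ell)}(x)$, that is, the set of all $(c_0,\ldots,c_{n-1})$ for which $c_0+c_1x+\cdots+c_{n-1}x^{n-1}$ lies in the ideal generated by $g_{(q,m,\ell)}(x)$ in $\mathrm{GF}(q)[x]/(x^n-\lambda)$. The following hold. 1. $\mathcal C_{(q,m,\ell)}$ is $\lambda$-constacyclic, has dimension $n-K_{(q,m,\ell)}$, and its minimum Hamming distance $d$ satisfies $d\ge d_{(q,m,\ell)}$, where $$d_{(q,m,\ell)}=\begin{cases} 2q^\ell+1 & \text{if } m \text{ is odd and } 0\le\ell\le (m-3)/2,\\ & \text{or } m\equiv 0 \pmod 4 \text{ and } 0\le \ell\le (m-4)/2,\\ & \text{or } m\equiv 2 \pmod 4 \text{ and } 0\le \ell\le (m-6)/2,\\ q^{(m-4)/2}+1 & \text{if } m\equiv 2 \pmod 4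 \text{ and } (m-4)/2\le \ell\le (m+2)/2,\\ q^{(m-2)/2}+1 & \text{if } m\equiv 0 \pmod 4 \text{ and } \ell\in\{(m-2)/2,\,m/2\},\\ q^{(m-1)/2}+1 & \text{if } m \text{ is odd and } \ell=(m-1)/2,\\ (q-1)q^{m-1-\ell}+1 & \text{otherwise.} \end{cases}$$ 2. $\mathcal C_{(q,m,\ell)}^\perp$ is $\lambda^{-1}$-constacyclic, has dimension $K_{(q,m,\ell)}$, and its minimum Hamming distance $d^\perp$ satisfies $$d^\perp\ \ge\ q^{m-1-\ell}+\frac{2(q^\ell-1)}{q-1}.$$ -/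

import Mathlib

namespace ConstaCode

open Polynomial

/-- The `q`-weight of `i`: the sum of the digits of `i` in base `q`. -/
def qWeight (q i : ℕ) : ℕ := (Nat.digits q i).sum

/-- `Ω = {1 + (q - 1) i : 0 ≤ i ≤ n - 1}` with `n = (q ^ m - 1) / (q - 1)`: the exponents `j` for
which `β ^ j` is a root of `x ^ n - λ`. -/
def rootExponents (q m : ℕ) : Set ℕ :=
  {j | ∃ i < (q ^ m - 1) / (q - 1), j = 1 + (q - 1) * i}

/-- The set `T_{(q,m,ℓ)}` of all `i ∈ {0, …, q ^ m - 2}` of `q`-weight `1 + (q - 1) ℓ`. -/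
def weightSet (q m l : ℕ) : Finset ℕ :=
  (Finset.range (q ^ m - 1)).filter (fun i => qWeight q i = 1 + (q - 1) * l)

/-- The polynomial `∏ (x - β ^ i)`, `i ∈ T_{(q,m,ℓ)}`, over the extension field. -/
noncomputable def rootPoly {K : Type*} [Field K] (β : K) (q m l : ℕ) : K[X] :=
  ∏ i ∈ weightSet q m l, (X - C (β ^ i))

/-- The map `(c_0, …, c_{n-1}) ↦ c_0 + c_1 x + ⋯ + c_{n-1} x ^ (n-1)` from `F ^ n` to
`F[x] / (x ^ n - λ)`. -/
noncomputable def toQuotient {F : Type*} [Field F] (lam : F) (n : ℕ) :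
    (Fin n → F) →ₗ[F] AdjoinRoot ((X : F[X]) ^ n - C lam) :=
  (AdjoinRoot.mkₐ ((X : F[X]) ^ n - C lam)).toLinearMap ∘ₗ
    (∑ i : Fin n, Polynomial.monomial (i : ℕ) ∘ₗ LinearMap.proj i)

/-- The code of length `n` that corresponds to the ideal `(g)` of `F[x] / (x ^ n - λ)`. -/
noncomputable def polyCode {F : Type*} [Field F] (lam : F) (n : ℕ) (g : F[X]) :
    Submodule F (Fin n → F) :=
  ((Ideal.span {AdjoinRoot.mk ((X : F[X]) ^ n - C lam) g}).restrictScalars F).comap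
    (toQuotient lam n)

/-- The constacyclic shift `(c_0, …, c_{n-1}) ↦ (λ c_{n-1}, c_0, …, c_{n-2})`. -/
def constaShift {F : Type*} [Field F] (lam : F) {n : ℕ} (c : Fin n → F) : Fin n → F :=
  fun i => if i.val = 0 then lam * c ⟨n - 1, by have := i.isLt; omega⟩
    else c ⟨i.val - 1, by have := i.isLt; omega⟩

/-- A linear code is `λ`-constacyclic if it is closed under the `λ`-constacyclic shift. -/
def IsConstacyclic {F : Type*} [Field F] (lam : F) {n : ℕ} (D : Submodule F (Fin n → F)) : Prop :=
  ∀ c ∈ D, constaShift lam c ∈ D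

/-- The dual code, with respect to the standard bilinear form. -/
def dualCode {F : Type*} [Field F] {n : ℕ} (D : Submodule F (Fin n → F)) :
    Submodule F (Fin n → F) where
  carrier := {a | ∀ b ∈ D, ∑ i, a i * b i = 0}
  zero_mem' := by intro b _; simp
  add_mem' := by
    intro a a' ha ha' b hb
    have h1 := ha b hb
    have h2 := ha' b hb
    simp [add_mul, Finset.sum_add_distrib, h1, h2]
  smul_mem' := by
    intro t a ha b hb
    have h1 := ha b hb
    simp [mul_assoc, ← Finset.mul_sum, h1]

/-- The minimum Hamming distance of two distinct codewords. For a code with at most one word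
this is `0`, so that a positive lower bound for it says that the code is nontrivial, too. -/
noncomputable def minDist {F : Type*} [Field F] [DecidableEq F] {n : ℕ}
    (D : Submodule F (Fin n → F)) : ℕ :=
  sInf {d | ∃ x ∈ D, ∃ y ∈ D, x ≠ y ∧ d = hammingDist x y}

/-- The binomial coefficient of integers; it is `0` when the lower entry is negative. -/
noncomputable def intBinom (a b : ℤ) : ℤ := if b < 0 then 0 else Ring.choose a b.toNat

/-- `∑_{h=0}^{m} (-1)^h binom(m, h) binom((q-1)ℓ - hq + m, 1 + (q-1)ℓ - hq)`. -/
noncomputable def binomSum (q m l : ℕ) : ℤ :=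
  ∑ h ∈ Finset.range (m + 1), (-1) ^ h * (m.choose h : ℤ) *
    intBinom (((q : ℤ) - 1) * l - h * q + m) (1 + ((q : ℤ) - 1) * l - h * q)

/-- The bound `d_{(q,m,ℓ)}`. The exponents `(m-4)/2`, `(m-2)/2`, `(m-1)/2` are integers in the
cases where they are used; the first one is `-1` when `m = 2`. -/
noncomputable def distBound (q m l : ℕ) : ℚ :=
  if (m % 2 = 1 ∧ (l : ℚ) ≤ ((m : ℚ) - 3) / 2) ∨
      (m % 4 = 0 ∧ (l : ℚ) ≤ ((m : ℚ) - 4) / 2) ∨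
      (m % 4 = 2 ∧ (l : ℚ) ≤ ((m : ℚ) - 6) / 2) then
    2 * (q : ℚ) ^ l + 1
  else if m % 4 = 2 ∧ ((m : ℚ) - 4) / 2 ≤ l ∧ (l : ℚ) ≤ ((m : ℚ) + 2) / 2 then
    (q : ℚ) ^ (((m : ℤ) - 4) / 2) + 1
  else if m % 4 = 0 ∧ ((l : ℚ) = ((m : ℚ) - 2) / 2 ∨ (l : ℚ) = (m : ℚ) / 2) then
    (q : ℚ) ^ (((m : ℤ) - 2) / 2) + 1
  else if m % 2 = 1 ∧ (l : ℚ) = ((m : ℚ) - 1) / 2 then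
    (q : ℚ) ^ (((m : ℤ) - 1) / 2) + 1
  else
    ((q : ℚ) - 1) * (q : ℚ) ^ ((m : ℤ) - 1 - l) + 1

/-- The bound `q ^ (m-1-ℓ) + 2 (q ^ ℓ - 1) / (q - 1)` for the dual code. -/
noncomputable def dualDistBound (q m l : ℕ) : ℚ :=
  (q : ℚ) ^ ((m : ℤ) - 1 - l) + 2 * ((q : ℚ) ^ l - 1) / ((q : ℚ) - 1)

end ConstaCode

namespace ConstaCode

open Polynomial

/-! ### The `q`-weight -/

/-! Multiplication by `q` modulo `q ^ m - 1` rotates the `m` base-`q` digits, so the weight set is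
stable under it and Frobenius permutes the factors of `rootPoly`, whose coefficients therefore lie
in `F`. A number is congruent to its digit sum modulo `q - 1`, so every exponent in the set is 1
modulo `q - 1` and gives a root of `x ^ n - λ`. The redundancy is the size of the set, read off from
the generating function `((1 - x ^ q) / (1 - x)) ^ m` (`card_weightSet`).

Both distance bounds are BCH bounds (`lt_hammingNorm`). For the code, the zeros run in steps of `q ^
a - 1` with `a` prime to `m`; then `β ^ (q ^ a - 1)` has order `n`. Such a step adds 1 to a high
block of digits and subtracts 1 from a low one, and the two blocks are kept complementary, so the
weight never changes (`progression_two_mul_pow`, `progression_pow`, `progression_compl`). The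
exponent `a` is the largest of a simple shape below `m / 2`, according to `m` modulo 4.

The dual vanishes at `β ^ (-j)` for `j` congruent to 1 modulo `q - 1` outside the weight set
(`sum_eq_zero_of_mem_dualCode`, by traces). A run of such `j` with step `q - 1` straddles the
wrap-around at `q ^ m - 1`: before it the weights are too large, after it too small
(`progression_notMem`). -/

@[simp] lemma qWeight_zero (q : ℕ) : qWeight q 0 = 0 := by simp [qWeight]

lemma qWeight_add_mul {q d : ℕ} (i : ℕ) (hq : 1 < q) (hd : d < q) :
    qWeight q (d + q * i) = d + qWeight q i := by
  by_cases h : d = 0 ∧ i = 0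
  · simp [h.1, h.2]
  · rw [qWeight, Nat.digits_add q hq d i hd (by tauto)]
    simp [qWeight]

lemma qWeight_of_lt {q d : ℕ} (hq : 1 < q) (hd : d < q) : qWeight q d = d := by
  simpa using qWeight_add_mul 0 hq hd

lemma qWeight_add_pow_mul {q k x : ℕ} (y : ℕ) (hq : 1 < q) (hx : x < q ^ k) :
    qWeight q (x + q ^ k * y) = qWeight q x + qWeight q y := by
  induction k generalizing x with
  | zero => simp [show x = 0 by simpa using hx]
  | succ k ih =>
    have hdiv : x / q < q ^ k := Nat.div_lt_of_lt_mul (by rwa [pow_succ'] at hx)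
    have hmod : x % q < q := Nat.mod_lt _ (by omega)
    have h1 : x + q ^ (k + 1) * y = x % q + q * (x / q + q ^ k * y) := by
      conv_lhs => rw [← Nat.mod_add_div x q]
      ring
    rw [h1, qWeight_add_mul _ hq hmod, ih hdiv]
    conv_rhs => rw [← Nat.mod_add_div x q, qWeight_add_mul _ hq hmod]
    ring

/-- Subtracting from `q ^ k - 1` never borrows: each digit `d` becomes `q - 1 - d`. -/
lemma qWeight_add_qWeight_compl {q k x : ℕ} (hq : 1 < q) (hx : x < q ^ k) :
    qWeight q x + qWeight q (q ^ k - 1 - x) = (q - 1) * k := by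
  induction k generalizing x with
  | zero => simp [show x = 0 by simpa using hx]
  | succ k ih =>
    have hdiv : x / q < q ^ k := Nat.div_lt_of_lt_mul (by rwa [pow_succ'] at hx)
    have hmod : x % q < q := Nat.mod_lt _ (by omega)
    have hx' := Nat.mod_add_div x q
    obtain ⟨z, hz⟩ := Nat.exists_eq_add_of_lt hdiv
    obtain ⟨e, he⟩ := Nat.exists_eq_add_of_lt hmod
    have h1 : q ^ (k + 1) - 1 - x = e + q * (q ^ k - 1 - x / q) := by
      have hz' : q ^ k - 1 - x / q = z := by omega
      have hpow : q ^ (k + 1) = q * (x / q) + q * z + q := by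
        rw [pow_succ', hz]; ring
      rw [hz', hpow]
      omega
    rw [h1, qWeight_add_mul _ hq (by omega)]
    conv_lhs => rw [← hx', qWeight_add_mul _ hq hmod]
    have := ih hdiv
    rw [hx', mul_add, ← this]
    omega

lemma qWeight_modEq {q : ℕ} (hq : 2 < q) (i : ℕ) : qWeight q i ≡ i [MOD (q - 1)] := by
  have h : q % (q - 1) = 1 := by
    rw [Nat.mod_eq_sub_mod (by omega), show q - (q - 1) = 1 by omega, Nat.mod_eq_of_lt (by omega)]
  exact (Nat.modEq_digits_sum (q - 1) q h i).symm

lemma qWeight_pos {q x : ℕ} (hq : 1 < q) (hx : x ≠ 0) : 0 < qWeight q x := by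
  induction x using Nat.strong_induction_on with
  | _ x ih =>
    have hmod : x % q < q := Nat.mod_lt _ (by omega)
    rw [← Nat.mod_add_div x q, qWeight_add_mul _ hq hmod]
    by_cases h : x % q = 0
    · have h1 : x / q ≠ 0 := by
        intro h0
        exact hx (by rw [← Nat.mod_add_div x q, h, h0]; simp)
      have := ih (x / q) (Nat.div_lt_self (by omega) hq) h1
      omega
    · omega

/-- The digits of `t * q ^ r - 1` are `t - 1` followed by `r` copies of `q - 1`, so the subtraction
is again digitwise. -/
lemma qWeight_add_qWeight_sub {q t r i : ℕ} (hq : 1 < q) (ht : t ≤ q) (hi : i < t * q ^ r) :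
    qWeight q i + qWeight q (t * q ^ r - 1 - i) = (q - 1) * r + (t - 1) := by
  have hpos : 0 < q ^ r := by positivity
  have hmod : i % q ^ r < q ^ r := Nat.mod_lt _ hpos
  have hdiv : i / q ^ r < t := Nat.div_lt_of_lt_mul (by rwa [mul_comm] at hi)
  have hi' := Nat.mod_add_div i (q ^ r)
  obtain ⟨e, he⟩ := Nat.exists_eq_add_of_lt hdiv
  have h1 : t * q ^ r - 1 - i = (q ^ r - 1 - i % q ^ r) + q ^ r * e := by
    have hpow : t * q ^ r = q ^ r * (i / q ^ r) + q ^ r * e + q ^ r := by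
      conv_lhs => rw [he]
      ring
    omega
  rw [h1, qWeight_add_pow_mul _ hq (lt_of_le_of_lt (Nat.sub_le _ _) (by omega)),
    qWeight_of_lt hq (show e < q by linarith [Nat.zero_le (i / q ^ r)])]
  conv_lhs =>
    rw [← hi', qWeight_add_pow_mul _ hq hmod, qWeight_of_lt hq (hdiv.trans_le ht)]
  have := qWeight_add_qWeight_compl hq hmod
  have : t - 1 = i / q ^ r + e := by rw [he]; rfl
  rw [hi', this]
  linarith

lemma qWeight_two_mul_pow_sub_one {q k : ℕ} (hq : 1 < q) :
    qWeight q (2 * q ^ k - 1) = 1 + (q - 1) * k := by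
  have hpos : 0 < q ^ k := by positivity
  have := qWeight_add_qWeight_sub (r := k) (i := 0) (t := 2) hq (by omega) (by omega)
  simp only [qWeight_zero, Nat.sub_zero] at this
  omega

/-- The least number of weight `(q - 1) * k + r` is `(r + 1) * q ^ k - 1`: low digits are filled
first. -/
lemma qWeight_lt {q k r x : ℕ} (hq : 1 < q) (hr : r < q) (hx : x + 1 < (r + 1) * q ^ k) :
    qWeight q x < (q - 1) * k + r := by
  have hpos : 0 < q ^ k := by positivity
  have hmod : x % q ^ k < q ^ k := Nat.mod_lt _ hpos
  have hx' := Nat.mod_add_div x (q ^ k)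
  have hdiv : x / q ^ k < r + 1 := Nat.div_lt_of_lt_mul (by rw [mul_comm]; omega)
  have h1 := qWeight_add_qWeight_compl hq hmod
  have h2 : qWeight q x = qWeight q (x % q ^ k) + x / q ^ k := by
    conv_lhs =>
      rw [← hx', qWeight_add_pow_mul _ hq hmod, qWeight_of_lt hq (show x / q ^ k < q by omega)]
  rcases Nat.lt_succ_iff_lt_or_eq.mp hdiv with h | h
  · omega
  · have h3 : q ^ k - 1 - x % q ^ k ≠ 0 := by
      rw [h] at hx'
      have : (r + 1) * q ^ k = q ^ k * r + q ^ k := by ring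
      omega
    have := qWeight_pos hq h3
    omega

/-- Since `q ^ m` is 1 modulo `q ^ m - 1`, the leading digit moves to the lowest place: a cyclic
rotation. -/
lemma qWeight_mul_mod {q m x : ℕ} (hq : 1 < q) (hm : 0 < m) (hx : x < q ^ m - 1) :
    qWeight q (q * x % (q ^ m - 1)) = qWeight q x := by
  obtain ⟨k, rfl⟩ : ∃ k, m = k + 1 := ⟨m - 1, by omega⟩
  have hpos : 0 < q ^ k := by positivity
  have hmod : x % q ^ k < q ^ k := Nat.mod_lt _ hpos
  have hx' := Nat.mod_add_div x (q ^ k)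
  have hdiv : x / q ^ k < q := Nat.div_lt_of_lt_mul (by rw [← pow_succ]; omega)
  have hpow : q ^ (k + 1) = q * q ^ k := pow_succ' q k
  have h1 : q * x = (x / q ^ k + q * (x % q ^ k)) + (q ^ (k + 1) - 1) * (x / q ^ k) := by
    have h2 : (q ^ (k + 1) - 1) * (x / q ^ k) + x / q ^ k = q * (q ^ k * (x / q ^ k)) := by
      rw [Nat.sub_mul, one_mul, Nat.sub_add_cancel (Nat.le_mul_of_pos_left _ (by positivity)), hpow]
      ring
    conv_lhs => rw [← hx', mul_add, ← h2]
    ring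
  -- The rotated number is already reduced, because `x` does not have all digits `q - 1`.
  have h3 : x / q ^ k + q * (x % q ^ k) < q ^ (k + 1) - 1 := by
    by_contra! hge
    obtain ⟨z, hz⟩ := Nat.exists_eq_add_of_lt hmod
    have h4 : q ^ (k + 1) = q * (x % q ^ k) + q * z + q := by rw [hpow]; nlinarith
    have h5 : q * z = 0 := by
      rcases Nat.eq_zero_or_pos z with h | h
      · simp [h]
      · have : q ≤ q * z := Nat.le_mul_of_pos_right _ h
        omega
    have h6 : z = 0 := by
      rcases Nat.mul_eq_zero.mp h5 with h | h <;> omega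
    have h7 : x / q ^ k = q - 1 := by omega
    have h8 : q ^ k * (x / q ^ k) + q ^ k = q ^ (k + 1) := by
      rw [h7, hpow, ← Nat.mul_succ, mul_comm]
      congr 1
      omega
    omega
  rw [h1, Nat.add_mul_mod_self_left, Nat.mod_eq_of_lt h3, qWeight_add_mul _ hq hdiv]
  conv_rhs => rw [← hx', qWeight_add_pow_mul _ hq hmod, qWeight_of_lt hq hdiv]
  ring

/-! ### The exponents of weight `1 + (q - 1) l` -/

lemma mem_weightSet {q m l i : ℕ} :
    i ∈ weightSet q m l ↔ i < q ^ m - 1 ∧ qWeight q i = 1 + (q - 1) * l := by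
  simp [weightSet]

lemma weight_lt {q m l : ℕ} (hq : 2 < q) (hl : l < m) : 1 + (q - 1) * l < (q - 1) * m := by
  obtain ⟨k, rfl⟩ := Nat.exists_eq_add_of_lt hl
  have h1 : (q - 1) * (l + k + 1) = (q - 1) * l + (q - 1) * k + (q - 1) := by ring
  omega

/-- The one extra candidate, `q ^ m - 1`, has weight `(q - 1) * m`, which is too large. -/
lemma mem_weightSet_of_lt {q m l i : ℕ} (hq : 2 < q) (hl : l < m) (hi : i < q ^ m)
    (hw : qWeight q i = 1 + (q - 1) * l) : i ∈ weightSet q m l := by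
  refine mem_weightSet.mpr ⟨?_, hw⟩
  have h1 := qWeight_add_qWeight_compl (by omega) hi
  have h2 := weight_lt hq hl
  have h3 : q ^ m - 1 - i ≠ 0 := by
    intro h
    rw [h, qWeight_zero] at h1
    omega
  omega

lemma modEq_one_of_mem_weightSet {q m l i : ℕ} (hq : 2 < q) (hi : i ∈ weightSet q m l) :
    i ≡ 1 [MOD (q - 1)] := by
  have h := qWeight_modEq hq i
  rw [(mem_weightSet.mp hi).2] at h
  exact h.symm.trans (by simp [Nat.ModEq])

lemma mul_mod_mem_weightSet {q m l i : ℕ} (hq : 1 < q) (hm : 0 < m)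
    (hi : i ∈ weightSet q m l) : q * i % (q ^ m - 1) ∈ weightSet q m l := by
  obtain ⟨h1, h2⟩ := mem_weightSet.mp hi
  exact mem_weightSet.mpr ⟨Nat.mod_lt _ (by omega), by rw [qWeight_mul_mod hq hm h1, h2]⟩

lemma two_mul_pow_sub_one_mem_weightSet {q m l : ℕ} (hq : 2 < q) (hl : l < m) :
    2 * q ^ l - 1 ∈ weightSet q m l := by
  refine mem_weightSet_of_lt hq hl ?_ (qWeight_two_mul_pow_sub_one (by omega))
  have h1 : q ^ (l + 1) ≤ q ^ m := Nat.pow_le_pow_right (by omega) hl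
  have h2 : 3 * q ^ l ≤ q ^ (l + 1) := by rw [pow_succ']; gcongr; omega
  have : 0 < q ^ l := by positivity
  omega

lemma mem_rootExponents {q m j : ℕ} (hq : 2 < q) :
    j ∈ rootExponents q m ↔ j < q ^ m - 1 ∧ j ≡ 1 [MOD (q - 1)] := by
  obtain ⟨n, hn⟩ : q - 1 ∣ q ^ m - 1 := by simpa using Nat.sub_dvd_pow_sub_pow q 1 m
  have hn' : (q ^ m - 1) / (q - 1) = n := by rw [hn, Nat.mul_div_cancel_left _ (by omega)]
  simp only [rootExponents, Set.mem_ofPred_eq, hn']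
  rw [hn]
  constructor
  · rintro ⟨i, hi, rfl⟩
    refine ⟨?_, by simp [Nat.ModEq]⟩
    have : (q - 1) * (i + 1) ≤ (q - 1) * n := Nat.mul_le_mul_left _ hi
    rw [mul_add] at this
    omega
  · rintro ⟨h1, h2⟩
    have hj : 1 ≤ j := by
      by_contra h0
      obtain rfl : j = 0 := by omega
      have := Nat.le_of_dvd one_pos ((Nat.modEq_zero_iff_dvd).mp h2.symm)
      omega
    obtain ⟨i, hi⟩ := (Nat.modEq_iff_dvd' hj).mp h2.symm
    refine ⟨i, ?_, by omega⟩
    have : (q - 1) * i < (q - 1) * n := by omega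
    exact lt_of_mul_lt_mul_left this (by omega)

lemma mem_rootExponents_of_mem_weightSet {q m l i : ℕ} (hq : 2 < q)
    (hi : i ∈ weightSet q m l) : i ∈ rootExponents q m :=
  (mem_rootExponents hq).mpr ⟨(mem_weightSet.mp hi).1, modEq_one_of_mem_weightSet hq hi⟩

lemma card_weightSet_pos {q m l : ℕ} (hq : 2 < q) (hl : l < m) : 0 < (weightSet q m l).card :=
  Finset.card_pos.mpr ⟨_, two_mul_pow_sub_one_mem_weightSet hq hl⟩

/-- Another weight class is nonempty and also lies among the `n` admissible exponents. This makes
the code nonzero. -/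
lemma card_weightSet_lt {q m l : ℕ} (hq : 2 < q) (hm : 2 ≤ m) :
    (weightSet q m l).card < (q ^ m - 1) / (q - 1) := by
  obtain ⟨l', hl', hne⟩ : ∃ l' < m, l' ≠ l := by
    rcases Nat.eq_zero_or_pos l with h | h
    · exact ⟨1, by omega, by omega⟩
    · exact ⟨0, by omega, by omega⟩
  have hmem := two_mul_pow_sub_one_mem_weightSet hq hl'
  have hsub : weightSet q m l ⊂
      (Finset.range ((q ^ m - 1) / (q - 1))).image (fun i => 1 + (q - 1) * i) := by
    have himage : ∀ k, ∀ i ∈ weightSet q m k, i ∈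
        (Finset.range ((q ^ m - 1) / (q - 1))).image (fun i => 1 + (q - 1) * i) := by
      intro k i hi
      obtain ⟨j, hj, rfl⟩ := mem_rootExponents_of_mem_weightSet hq hi
      exact Finset.mem_image.mpr ⟨j, Finset.mem_range.mpr hj, rfl⟩
    refine Finset.ssubset_iff_of_subset (himage l) |>.mpr ⟨_, himage _ _ hmem, fun h => hne ?_⟩
    have h1 := (mem_weightSet.mp h).2
    rw [(mem_weightSet.mp hmem).2] at h1
    exact Nat.eq_of_mul_eq_mul_left (by omega : 0 < q - 1) (by omega)
  calc _ < _ := Finset.card_lt_card hsub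
    _ ≤ _ := Finset.card_image_le
    _ = _ := Finset.card_range _

/-! ### Counting integers by weight -/

/-- The `m` digits range independently over `0, …, q - 1`. -/
lemma sum_X_pow_qWeight {q : ℕ} (hq : 1 < q) (m : ℕ) :
    ∑ i ∈ Finset.range (q ^ m), (PowerSeries.X : PowerSeries ℤ) ^ qWeight q i =
      (∑ d ∈ Finset.range q, PowerSeries.X ^ d) ^ m := by
  induction m with
  | zero => simp
  | succ m ih =>
    rw [pow_succ' (∑ d ∈ Finset.range q, _), ← ih, Finset.sum_mul_sum, ← Finset.sum_product']
    refine Finset.sum_bij' (fun i _ => (i % q, i / q)) (fun p _ => p.1 + q * p.2) ?_ ?_ ?_ ?_ ?_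
    · intro i hi
      rw [Finset.mem_range, pow_succ'] at hi
      simp only [Finset.mem_product, Finset.mem_range]
      exact ⟨Nat.mod_lt _ (by omega), Nat.div_lt_of_lt_mul hi⟩
    · rintro ⟨d, i⟩ hp
      simp only [Finset.mem_product, Finset.mem_range] at hp ⊢
      have : q * (i + 1) ≤ q * q ^ m := Nat.mul_le_mul_left _ hp.2
      rw [pow_succ']
      linarith
    · intro i _
      exact Nat.mod_add_div i q
    · rintro ⟨d, i⟩ hp
      simp only [Finset.mem_product, Finset.mem_range] at hp
      simp [Nat.add_mul_mod_self_left, Nat.mod_eq_of_lt hp.1, Nat.add_mul_div_left _ _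
        (show 0 < q by omega), Nat.div_eq_of_lt hp.1]
    · intro i _
      simp only
      rw [← pow_add, ← qWeight_add_mul _ hq (Nat.mod_lt _ (by omega)), Nat.mod_add_div]

lemma card_filter_qWeight {q : ℕ} (hq : 1 < q) (d s : ℕ) :
    (((Finset.range (q ^ (d + 1))).filter (fun i => qWeight q i = s)).card : ℤ) =
      ∑ h ∈ Finset.range (d + 1 + 1), (-1) ^ h * ((d + 1).choose h : ℤ) *
        if q * h ≤ s then ((d + (s - q * h)).choose d : ℤ) else 0 := by
  have h1 := sum_X_pow_qWeight hq (d + 1)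
  have h2 : (∑ e ∈ Finset.range q, (PowerSeries.X : PowerSeries ℤ) ^ e) ^ (d + 1) =
      (1 - PowerSeries.X ^ q) ^ (d + 1) *
        (PowerSeries.mk fun n => ((d + n).choose d : ℤ)) := by
    rw [← geom_sum_mul_neg, mul_pow, mul_assoc,
      mul_comm (_ ^ _) (PowerSeries.mk _), PowerSeries.mk_add_choose_mul_one_sub_pow_eq_one, mul_one]
  have h3 : ((1 : PowerSeries ℤ) - PowerSeries.X ^ q) ^ (d + 1) =
      ∑ h ∈ Finset.range (d + 1 + 1),
        PowerSeries.C ((-1) ^ h * ((d + 1).choose h : ℤ)) * PowerSeries.X ^ (q * h) := by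
    rw [sub_eq_neg_add, add_pow]
    refine Finset.sum_congr rfl fun h _ => ?_
    rw [neg_pow, pow_mul]
    simp
    ring
  rw [h2, h3, Finset.sum_mul] at h1
  have h4 := congrArg (PowerSeries.coeff s) h1
  rw [map_sum, map_sum] at h4
  simp only [PowerSeries.coeff_X_pow, mul_assoc, PowerSeries.coeff_C_mul,
    PowerSeries.coeff_X_pow_mul', PowerSeries.coeff_mk] at h4
  simp only [mul_assoc]
  rw [← h4, Finset.card_filter]
  push_cast
  exact Finset.sum_congr rfl fun i _ => by simp [eq_comm]

/-- The generating function gives binomials with lower entry `m - 1`; symmetry turns them into those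
of `binomSum`, and terms with `q * h` above the weight vanish on both sides. -/
lemma card_weightSet {q m l : ℕ} (hq : 2 < q) (hl : l < m) :
    ((weightSet q m l).card : ℤ) = binomSum q m l := by
  obtain ⟨d, rfl⟩ : ∃ d, m = d + 1 := ⟨m - 1, by omega⟩
  have h1 : weightSet q (d + 1) l =
      (Finset.range (q ^ (d + 1))).filter (fun i => qWeight q i = 1 + (q - 1) * l) := by
    ext i
    simp only [Finset.mem_filter, Finset.mem_range]
    refine ⟨fun h => ?_, fun h => mem_weightSet_of_lt hq hl h.1 h.2⟩
    have := mem_weightSet.mp h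
    exact ⟨by omega, this.2⟩
  rw [h1, card_filter_qWeight (by omega), binomSum]
  refine Finset.sum_congr rfl fun h _ => ?_
  congr 1
  have hcast : 1 + ((q : ℤ) - 1) * l = ((1 + (q - 1) * l : ℕ) : ℤ) := by
    push_cast [show 1 ≤ q by omega]
    ring
  have hcast' : ((q : ℤ) - 1) * l - h * q + ((d + 1 : ℕ) : ℤ) =
      d + (((1 + (q - 1) * l : ℕ) : ℤ) - (q * h : ℕ)) := by
    rw [← hcast]
    push_cast
    ring
  have hcast'' : 1 + ((q : ℤ) - 1) * l - h * q =
      ((1 + (q - 1) * l : ℕ) : ℤ) - (q * h : ℕ) := by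
    rw [hcast]
    push_cast
    ring
  rw [hcast', hcast'', intBinom]
  generalize 1 + (q - 1) * l = s
  split_ifs with h2 h3 h3
  · omega
  · obtain ⟨e, rfl⟩ := Nat.exists_eq_add_of_le h2
    have h4 : ((q * h + e : ℕ) : ℤ) - (q * h : ℕ) = (e : ℤ) := by push_cast; ring
    rw [h4, Int.toNat_natCast, ← Nat.cast_add, Ring.choose_natCast, Nat.add_sub_cancel_left,
      Nat.choose_symm_add]
  · rfl
  · omega

/-! ### Linear codes -/

section Codes

variable {F : Type*} [Field F] {n : ℕ}

/-- The polynomial `c_0 + c_1 x + ⋯ + c_{n-1} x ^ (n-1)`. -/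
noncomputable def toPoly (F : Type*) [Field F] (n : ℕ) : (Fin n → F) →ₗ[F] F[X] :=
  ∑ i : Fin n, Polynomial.monomial (i : ℕ) ∘ₗ LinearMap.proj i

lemma toPoly_apply (c : Fin n → F) : toPoly F n c = ∑ i : Fin n, monomial (i : ℕ) (c i) := by
  simp [toPoly]

lemma aeval_toPoly {K : Type*} [Field K] [Algebra F K] (c : Fin n → F) (x : K) :
    aeval x (toPoly F n c) = ∑ i : Fin n, algebraMap F K (c i) * x ^ (i : ℕ) := by
  simp [toPoly_apply, aeval_monomial]

lemma mem_polyCode {lam : F} {g : F[X]} (hg : g ∣ X ^ n - C lam) (c : Fin n → F) :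
    c ∈ polyCode lam n g ↔ g ∣ toPoly F n c := by
  change AdjoinRoot.mk (X ^ n - C lam) (toPoly F n c) ∈
    Ideal.span {AdjoinRoot.mk (X ^ n - C lam) g} ↔ _
  rw [Ideal.mem_span_singleton]
  constructor
  · rintro ⟨b, hb⟩
    obtain ⟨b, rfl⟩ := AdjoinRoot.mk_surjective b
    rw [← map_mul, AdjoinRoot.mk_eq_mk] at hb
    simpa using dvd_add (hg.trans hb) (dvd_mul_right g b)
  · exact fun h => map_dvd _ h

/-- The code is the kernel of the map from words to `F[x] / (g)`, which is onto since remainders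
modulo `g` have degree below `n`. -/
lemma finrank_polyCode {lam : F} {g : F[X]} (hn : 0 < n) (hg : g ∣ X ^ n - C lam) :
    Module.finrank F (polyCode lam n g) + g.natDegree = n := by
  have hne : (X ^ n - C lam : F[X]) ≠ 0 := X_pow_sub_C_ne_zero hn lam
  have hg0 : g ≠ 0 := ne_zero_of_dvd_ne_zero hne hg
  have hdeg : g.natDegree ≤ n := by
    simpa [natDegree_X_pow_sub_C] using natDegree_le_of_dvd hg hne
  let φ : (Fin n → F) →ₗ[F] AdjoinRoot g := (AdjoinRoot.mkₐ g).toLinearMap ∘ₗ toPoly F n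
  have hker : LinearMap.ker φ = polyCode lam n g := by
    ext c
    rw [mem_polyCode hg, LinearMap.mem_ker]
    exact AdjoinRoot.mk_eq_zero
  have hsurj : Function.Surjective φ := by
    intro y
    obtain ⟨p, rfl⟩ := AdjoinRoot.mk_surjective y
    refine ⟨fun i => (p % g).coeff i, ?_⟩
    have hp : toPoly F n (fun i => (p % g).coeff i) = p % g := by
      rw [toPoly_apply, Fin.sum_univ_eq_sum_range (fun i => monomial i ((p % g).coeff i)) n]
      refine (as_sum_range' _ _ ?_).symm
      by_cases h0 : p % g = 0
      · simpa [h0] using hn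
      · exact (natDegree_lt_natDegree h0 (degree_mod_lt p hg0)).trans_le hdeg
    change AdjoinRoot.mk g (toPoly F n _) = _
    rw [hp, AdjoinRoot.mk_eq_mk]
    exact ⟨-(p / g), by linear_combination EuclideanDomain.div_add_mod p g⟩
  have h := φ.finrank_range_add_finrank_ker
  rw [LinearMap.range_eq_top.mpr hsurj, finrank_top, hker, Module.finrank_fin_fun] at h
  rw [← finrank_quotient_span_eq_natDegree (f := g), add_comm]
  exact h

lemma finrank_dualCode (D : Submodule F (Fin n → F)) :
    Module.finrank F D + Module.finrank F (dualCode D) = n := by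
  have h : dualCode D =
      D.dualAnnihilator.comap (dotProductEquiv F (Fin n)).toLinearMap := by
    ext a
    simp only [Submodule.mem_comap, Submodule.mem_dualAnnihilator]
    rfl
  have h2 := Subspace.finrank_add_finrank_dualAnnihilator_eq D
  rw [Module.finrank_fin_fun] at h2
  rw [h]
  exact (congrArg _ (((dotProductEquiv F (Fin n)).ofSubmodule' D.dualAnnihilator).finrank_eq)).trans
    h2

/-- Modulo `x ^ n - λ` the shift is multiplication by `x`. -/
lemma sum_constaShift {K : Type*} [Field K] [Algebra F K] {lam : F} {x : K}
    (hx : x ^ n = algebraMap F K lam) (c : Fin n → F) :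
    ∑ i, algebraMap F K (constaShift lam c i) * x ^ (i : ℕ) =
      x * ∑ i, algebraMap F K (c i) * x ^ (i : ℕ) := by
  cases n with
  | zero => simp
  | succ k =>
    rw [Fin.sum_univ_succ, Fin.sum_univ_castSucc (f := fun i => algebraMap F K (c i) * x ^ (i : ℕ))]
    have h1 : ∀ i : Fin k, constaShift lam c i.succ = c i.castSucc := fun i => by
      simp [constaShift]; rfl
    have h2 : constaShift lam c 0 = lam * c (Fin.last k) := by
      simp [constaShift]; left; rfl
    simp only [h1, h2, map_mul, ← hx, Fin.val_succ, Fin.val_castSucc, Fin.val_last, mul_add,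
      Finset.mul_sum, Fin.val_zero, pow_zero]
    rw [add_comm]
    congr 1
    · exact Finset.sum_congr rfl fun i _ => by ring
    · ring

lemma sum_constaShift_mul_constaShift {lam : F} (hlam : lam ≠ 0) (a b : Fin n → F) :
    ∑ i, constaShift lam⁻¹ a i * constaShift lam b i = ∑ i, a i * b i := by
  cases n with
  | zero => simp
  | succ k =>
    rw [Fin.sum_univ_succ, Fin.sum_univ_castSucc (f := fun i => a i * b i)]
    have h1 : ∀ (mu : F) (c : Fin (k + 1) → F) (i : Fin k),
        constaShift mu c i.succ = c i.castSucc := fun mu c i => by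
      simp [constaShift]; rfl
    have h2 : ∀ (mu : F) (c : Fin (k + 1) → F),
        constaShift mu c 0 = mu * c (Fin.last k) := fun mu c => by
      simp [constaShift]; left; rfl
    simp only [h1, h2]
    rw [add_comm]
    congr 1
    field_simp

/-- A `λ`-constacyclic shift is inverted by a shift in the other direction. -/
lemma exists_constaShift_eq {lam : F} (hlam : lam ≠ 0) (b : Fin n → F) :
    ∃ b', constaShift lam b' = b := by
  refine ⟨fun i => if h : i.val + 1 < n then b ⟨i.val + 1, h⟩
    else lam⁻¹ * b ⟨0, i.pos⟩, ?_⟩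
  funext ⟨i, hi⟩
  rcases Nat.eq_zero_or_pos i with rfl | h0
  · simp [constaShift, show ¬ (n - 1 + 1 < n) by omega, hlam]
  · simp [constaShift, show i ≠ 0 by omega, show i - 1 + 1 = i by omega, hi]

/-- The BCH bound. -/
lemma lt_hammingNorm [DecidableEq F] {K : Type*} [Field K] [Algebra F K] {u γ : K} (hu : u ≠ 0)
    (hγ : Function.Injective fun j : Fin n => γ ^ (j : ℕ)) {c : Fin n → F} (hc : c ≠ 0) {δ : ℕ}
    (h : ∀ i < δ, ∑ j, algebraMap F K (c j) * (u * γ ^ i) ^ (j : ℕ) = 0) :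
    δ < hammingNorm c := by
  by_contra! hle
  let S : Finset (Fin n) := Finset.univ.filter fun j => c j ≠ 0
  have hS : S.card ≤ δ := hle
  let e : Fin S.card ≃ S := S.equivFin.symm
  -- Vandermonde on the support of `c`: the nodes `γ ^ j` are distinct, and there are at least as
  -- many equations as unknowns `c j * u ^ j`.
  have hv : (fun k : Fin S.card => algebraMap F K (c (e k)) * u ^ (e k : ℕ)) = 0 := by
    refine Matrix.eq_zero_of_forall_pow_sum_mul_pow_eq_zero
      (f := fun k : Fin S.card => γ ^ ((e k : Fin n) : ℕ)) (fun k k' hk => ?_) fun i => ?_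
    · exact e.injective (Subtype.ext (hγ hk))
    · rw [Equiv.sum_comp e (fun s : S => algebraMap F K (c s) * u ^ ((s : Fin n) : ℕ) *
        (γ ^ ((s : Fin n) : ℕ)) ^ (i : ℕ)), Finset.sum_coe_sort S
        (fun s => algebraMap F K (c s) * u ^ (s : ℕ) * (γ ^ (s : ℕ)) ^ (i : ℕ)),
        Finset.sum_filter_of_ne, ← h i (i.2.trans_le hS)]
      · refine Finset.sum_congr rfl fun j _ => ?_
        rw [mul_pow, ← pow_mul, ← pow_mul, mul_comm (i : ℕ)]
        ring
      · intro j _ hj h0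
        simp [h0] at hj
  obtain ⟨j, hj⟩ := Function.ne_iff.mp hc
  have hjS : j ∈ S := by simpa [S] using hj
  have := congrFun hv (e.symm ⟨j, hjS⟩)
  simp [hu] at this
  exact hj this

/-- Nontriviality is essential: for `⊥` the infimum is taken over the empty set and equals 0. -/
lemma le_minDist [DecidableEq F] {D : Submodule F (Fin n → F)} (hD : D ≠ ⊥) {δ : ℕ}
    (h : ∀ c ∈ D, c ≠ 0 → δ ≤ hammingNorm c) : δ ≤ minDist D := by
  refine le_csInf ?_ ?_
  · obtain ⟨x, hx, hx0⟩ := D.ne_bot_iff.mp hD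
    exact ⟨_, x, hx, 0, D.zero_mem, hx0, rfl⟩
  · rintro d ⟨x, hx, y, hy, hne, rfl⟩
    rw [hammingDist_eq_hammingNorm]
    exact h _ (D.add_mem (D.neg_mem hx) hy) (by
      intro h0
      exact hne (neg_add_eq_zero.mp h0))

end Codes

/-! ### The code with roots `β ^ i` -/

/-- The standing assumptions: `F = GF(q)`, `K = GF(q ^ m)`, and `β` is a primitive element of `K`
with `β ^ n = λ`. -/
structure Setting {F K : Type*} [Field F] [Field K] [Algebra F K] (q m n : ℕ) (lam : F) (β : K) :
    Prop where
  two_lt : 2 < q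
  two_le : 2 ≤ m
  mul_eq : (q - 1) * n = q ^ m - 1
  card_eq : Nat.card F = q
  finrank_eq : Module.finrank F K = m
  primitive : IsPrimitiveRoot β (q ^ m - 1)
  pow_eq : β ^ n = algebraMap F K lam

namespace Setting

variable {F K : Type*} [Field F] [Field K] [Algebra F K] {q m n : ℕ} {lam : F} {β : K}

lemma finite_base (S : Setting q m n lam β) : Finite F :=
  Nat.finite_of_card_ne_zero (by have := S.card_eq; have := S.two_lt; omega)

lemma finiteDimensional (S : Setting q m n lam β) : FiniteDimensional F K :=
  Module.finite_of_finrank_pos (by have := S.finrank_eq; have := S.two_le; omega)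

lemma finite_top (S : Setting q m n lam β) : Finite K :=
  have := S.finite_base
  have := S.finiteDimensional
  Module.finite_of_finite F

lemma one_lt_pow (S : Setting q m n lam β) : 1 < q ^ m - 1 := by
  have h1 : q ≤ q ^ m := Nat.le_self_pow (by have := S.two_le; omega) q
  have := S.two_lt
  omega

lemma length_pos (S : Setting q m n lam β) : 0 < n := by
  have h := S.mul_eq
  have := S.one_lt_pow
  rcases Nat.eq_zero_or_pos n with rfl | h0
  · omega
  · exact h0

lemma ne_zero (S : Setting q m n lam β) : β ≠ 0 :=
  S.primitive.ne_zero (by have := S.one_lt_pow; omega)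

lemma lam_ne_zero (S : Setting q m n lam β) : lam ≠ 0 := by
  rintro rfl
  have := S.pow_eq
  rw [map_zero] at this
  exact S.ne_zero (eq_zero_of_pow_eq_zero this)

lemma pow_eq_pow_iff (S : Setting q m n lam β) {i j : ℕ} :
    β ^ i = β ^ j ↔ i ≡ j [MOD (q ^ m - 1)] := by
  rw [S.primitive.eq_orderOf]
  exact (S.primitive.isOfFinOrder (by have := S.one_lt_pow; omega)).pow_eq_pow_iff_modEq

lemma pow_mod (S : Setting q m n lam β) (i : ℕ) : β ^ (i % (q ^ m - 1)) = β ^ i :=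
  S.pow_eq_pow_iff.mpr (Nat.mod_modEq _ _)

lemma pow_inj (S : Setting q m n lam β) {i j : ℕ} (hi : i < q ^ m - 1) (hj : j < q ^ m - 1)
    (h : β ^ i = β ^ j) : i = j :=
  S.primitive.pow_inj hi hj h

lemma pow_pow_length (S : Setting q m n lam β) {j : ℕ} (hj : j ≡ 1 [MOD (q - 1)]) :
    (β ^ j) ^ n = algebraMap F K lam := by
  rw [← S.pow_eq, ← pow_mul, S.pow_eq_pow_iff, ← S.mul_eq]
  simpa using hj.mul_right' n

lemma pow_card_pow (S : Setting q m n lam β) (x : K) : x ^ q ^ m = x := by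
  have := S.finite_base
  have := S.finiteDimensional
  have := S.finite_top
  have := Fintype.ofFinite K
  have h := FiniteField.pow_card x
  rwa [← Nat.card_eq_fintype_card, Module.natCard_eq_pow_finrank (K := F), S.card_eq,
    S.finrank_eq] at h

lemma algebraMap_pow (S : Setting q m n lam β) (x : F) (k : ℕ) : x ^ q ^ k = x := by
  have := S.finite_base
  have := Fintype.ofFinite F
  rw [← S.card_eq, Nat.card_eq_fintype_card]
  exact FiniteField.pow_card_pow k x

lemma exists_pow_pow_eq (S : Setting q m n lam β) {l t : ℕ} (ht : t ∈ weightSet q m l) (k : ℕ) :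
    ∃ i ∈ weightSet q m l, (β ^ t) ^ q ^ k = β ^ i := by
  induction k with
  | zero => exact ⟨t, ht, by simp⟩
  | succ k ih =>
    obtain ⟨i, hi, h⟩ := ih
    refine ⟨_, mul_mod_mem_weightSet (by have := S.two_lt; omega)
      (by have := S.two_le; omega) hi, ?_⟩
    rw [S.pow_mod, pow_succ, pow_mul, h, ← pow_mul, mul_comm]

lemma injOn_pow (S : Setting q m n lam β) (l : ℕ) :
    Set.InjOn (fun i => β ^ i) (weightSet q m l) := fun _ hi _ hj h =>
  S.pow_inj (mem_weightSet.mp hi).1 (mem_weightSet.mp hj).1 h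

lemma rootPoly_dvd_iff (S : Setting q m n lam β) {l : ℕ} {p : K[X]} :
    rootPoly β q m l ∣ p ↔ ∀ i ∈ weightSet q m l, p.eval (β ^ i) = 0 := by
  constructor
  · intro h i hi
    exact dvd_iff_isRoot.mp ((Finset.dvd_prod_of_mem (fun i => X - C (β ^ i)) hi).trans h)
  · intro h
    refine Finset.prod_dvd_of_coprime (fun i hi j hj hij => ?_) fun i hi =>
      dvd_iff_isRoot.mpr (h i hi)
    refine isCoprime_X_sub_C_of_isUnit_sub (IsUnit.mk0 _ (sub_ne_zero.mpr fun h0 => hij ?_))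
    exact S.injOn_pow l hi hj h0

lemma eval_rootPoly_eq_zero_iff {l : ℕ} {x : K} :
    (rootPoly β q m l).eval x = 0 ↔ ∃ i ∈ weightSet q m l, x = β ^ i := by
  simp [rootPoly, eval_prod, Finset.prod_eq_zero_iff, sub_eq_zero]

lemma natDegree_rootPoly {l : ℕ} : (rootPoly β q m l).natDegree = (weightSet q m l).card := by
  rw [rootPoly, natDegree_prod_of_monic _ _ fun i _ => monic_X_sub_C _,
    Finset.sum_congr rfl fun i _ => natDegree_X_sub_C _, Finset.card_eq_sum_ones]

/-- The Galois group consists of powers of the `q`-Frobenius, so being fixed by that one map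
suffices. -/
lemma mem_range_algebraMap (S : Setting q m n lam β) {x : K} (hx : x ^ q = x) :
    x ∈ Set.range (algebraMap F K) := by
  have := S.finite_base
  have := S.finiteDimensional
  have := S.finite_top
  have := Fintype.ofFinite F
  rw [IsGalois.mem_range_algebraMap_iff_fixed]
  intro σ
  obtain ⟨k, rfl⟩ := (FiniteField.bijective_frobeniusAlgEquivOfAlgebraic_pow F K).2 σ
  rw [AlgEquiv.coe_pow, FiniteField.coe_frobeniusAlgEquivOfAlgebraic_iterate,
    ← Nat.card_eq_fintype_card, S.card_eq]
  generalize (k : ℕ) = k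
  induction k with
  | zero => simp
  | succ k ih => simpa [pow_succ, pow_mul, hx] using congrArg (· ^ q) ih

lemma exists_map_eq_rootPoly (S : Setting q m n lam β) (l : ℕ) :
    ∃ g : F[X], g.map (algebraMap F K) = rootPoly β q m l := by
  have := S.finite_base
  have := Fintype.ofFinite F
  let φ : K →+* K := (FiniteField.frobeniusAlgHom F K : K →ₐ[F] K)
  have hφ : ∀ x, φ x = x ^ q := fun x => by
    rw [← S.card_eq, Nat.card_eq_fintype_card]; rfl
  have hmap : (rootPoly β q m l).map φ = rootPoly β q m l := by
    have hmem : ∀ i ∈ weightSet q m l, q * i % (q ^ m - 1) ∈ weightSet q m l := fun i hi =>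
      mul_mod_mem_weightSet (by have := S.two_lt; omega) (by have := S.two_le; omega) hi
    have hinj : Set.InjOn (fun i => q * i % (q ^ m - 1)) (weightSet q m l) := by
      intro i hi j hj h
      have h1 : β ^ (q * i % (q ^ m - 1)) = β ^ (q * j % (q ^ m - 1)) := congrArg _ h
      rw [S.pow_mod, S.pow_mod, mul_comm q, mul_comm q, pow_mul, pow_mul, ← hφ, ← hφ] at h1
      exact S.injOn_pow l hi hj (φ.injective h1)
    rw [rootPoly, Polynomial.map_prod]
    refine Finset.prod_nbij (fun i => q * i % (q ^ m - 1)) hmem hinj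
      (Finset.surjOn_of_injOn_of_card_le _ hmem hinj le_rfl) fun i _ => ?_
    rw [Polynomial.map_sub, map_X, map_C, hφ, S.pow_mod, ← pow_mul, mul_comm]
  have hlift : rootPoly β q m l ∈ lifts (algebraMap F K) := by
    rw [lifts_iff_coeff_lifts]
    intro k
    refine S.mem_range_algebraMap ?_
    rw [← hφ, ← coeff_map, hmap]
  exact (mem_lifts _).mp hlift

variable {l : ℕ} {g : F[X]}

lemma dvd_X_pow_sub_C (S : Setting q m n lam β) (hg : g.map (algebraMap F K) = rootPoly β q m l) :
    g ∣ X ^ n - C lam := by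
  refine (map_dvd_map' (algebraMap F K)).mp ?_
  rw [hg, S.rootPoly_dvd_iff]
  intro i hi
  simp [S.pow_pow_length (modEq_one_of_mem_weightSet S.two_lt hi)]

lemma mem_polyCode_iff (S : Setting q m n lam β) (hg : g.map (algebraMap F K) = rootPoly β q m l)
    {c : Fin n → F} : c ∈ polyCode lam n g ↔
      ∀ i ∈ weightSet q m l, ∑ j, algebraMap F K (c j) * (β ^ i) ^ (j : ℕ) = 0 := by
  rw [mem_polyCode (S.dvd_X_pow_sub_C hg), ← map_dvd_map' (algebraMap F K), hg, S.rootPoly_dvd_iff]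
  refine forall₂_congr fun i _ => ?_
  rw [eval_map_algebraMap, aeval_toPoly]

lemma constaShift_mem_iff (S : Setting q m n lam β)
    (hg : g.map (algebraMap F K) = rootPoly β q m l) {c : Fin n → F} :
    constaShift lam c ∈ polyCode lam n g ↔ c ∈ polyCode lam n g := by
  rw [S.mem_polyCode_iff hg, S.mem_polyCode_iff hg]
  refine forall₂_congr fun i hi => ?_
  rw [sum_constaShift (S.pow_pow_length (modEq_one_of_mem_weightSet S.two_lt hi))]
  simp [S.ne_zero]

lemma isConstacyclic (S : Setting q m n lam β)
    (hg : g.map (algebraMap F K) = rootPoly β q m l) :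
    IsConstacyclic lam (polyCode lam n g) := fun _ hc => (S.constaShift_mem_iff hg).mpr hc

lemma isConstacyclic_dualCode (S : Setting q m n lam β)
    (hg : g.map (algebraMap F K) = rootPoly β q m l) :
    IsConstacyclic lam⁻¹ (dualCode (polyCode lam n g)) := by
  intro a ha b hb
  obtain ⟨b, rfl⟩ := exists_constaShift_eq S.lam_ne_zero b
  rw [sum_constaShift_mul_constaShift S.lam_ne_zero]
  exact ha b ((S.constaShift_mem_iff hg).mp hb)

lemma finrank_polyCode_add (S : Setting q m n lam β)
    (hg : g.map (algebraMap F K) = rootPoly β q m l) :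
    Module.finrank F (polyCode lam n g) + (weightSet q m l).card = n := by
  have h : g.natDegree = (weightSet q m l).card := by
    rw [← natDegree_rootPoly (β := β), ← hg, natDegree_map]
  rw [← h]
  exact finrank_polyCode S.length_pos (S.dvd_X_pow_sub_C hg)

lemma finrank_dualCode_eq (S : Setting q m n lam β)
    (hg : g.map (algebraMap F K) = rootPoly β q m l) :
    Module.finrank F (dualCode (polyCode lam n g)) = (weightSet q m l).card := by
  have h1 := S.finrank_polyCode_add hg
  have h2 := finrank_dualCode (polyCode lam n g)
  omega

lemma polyCode_ne_bot (S : Setting q m n lam β)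
    (hg : g.map (algebraMap F K) = rootPoly β q m l) : polyCode lam n g ≠ ⊥ := by
  intro h
  have h1 := S.finrank_polyCode_add hg
  have h2 := card_weightSet_lt (l := l) S.two_lt S.two_le
  rw [← S.mul_eq, Nat.mul_div_cancel_left _ (by have := S.two_lt; omega)] at h2
  rw [h, finrank_bot] at h1
  omega

lemma dualCode_ne_bot (S : Setting q m n lam β) (hl : l < m)
    (hg : g.map (algebraMap F K) = rootPoly β q m l) : dualCode (polyCode lam n g) ≠ ⊥ := by
  intro h
  have h1 := S.finrank_dualCode_eq hg
  have h2 := card_weightSet_pos S.two_lt hl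
  rw [h, finrank_bot] at h1
  omega

lemma rootExponents_inter (S : Setting q m n lam β)
    (hg : g.map (algebraMap F K) = rootPoly β q m l) :
    {i ∈ rootExponents q m | aeval (β ^ i) g = 0} = {i | i ∈ weightSet q m l} := by
  ext j
  simp only [Set.mem_ofPred_eq]
  rw [← eval_map_algebraMap, hg, eval_rootPoly_eq_zero_iff]
  constructor
  · rintro ⟨hj, i, hi, h⟩
    rwa [S.pow_inj ((mem_rootExponents S.two_lt).mp hj).1 (mem_weightSet.mp hi).1 h]
  · exact fun hj => ⟨mem_rootExponents_of_mem_weightSet S.two_lt hj, j, hj, rfl⟩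

/-- Otherwise `β ^ t` would be a conjugate of `β ^ j`; applying Frobenius `m - k` more times returns
to `β ^ j` and puts `j` in the weight set. -/
lemma pow_mul_pow_ne_one (S : Setting q m n lam β) {j t k : ℕ} (hj : j < q ^ m - 1)
    (hjT : j ∉ weightSet q m l) (ht : t ∈ weightSet q m l) (hk : k ≤ m) :
    (β ^ j)⁻¹ ^ q ^ k * β ^ t ≠ 1 := by
  intro h
  have h1 : β ^ t = (β ^ j) ^ q ^ k := by
    rw [inv_pow] at h
    exact eq_of_inv_mul_eq_one h |>.symm
  obtain ⟨i, hi, h2⟩ := S.exists_pow_pow_eq ht (m - k)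
  rw [h1, ← pow_mul, ← pow_add, Nat.add_sub_cancel' hk, S.pow_card_pow] at h2
  rw [S.pow_inj hj (mem_weightSet.mp hi).1 h2] at hjT
  exact hjT hi

/-- The zeros of the dual code. -/
lemma sum_eq_zero_of_mem_dualCode (S : Setting q m n lam β)
    (hg : g.map (algebraMap F K) = rootPoly β q m l) {a : Fin n → F}
    (ha : a ∈ dualCode (polyCode lam n g)) {j : ℕ} (hj : j < q ^ m - 1)
    (hj1 : j ≡ 1 [MOD (q - 1)]) (hjT : j ∉ weightSet q m l) :
    ∑ i, algebraMap F K (a i) * (β ^ j)⁻¹ ^ (i : ℕ) = 0 := by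
  have := S.finite_base
  have := S.finiteDimensional
  have := S.finite_top
  set x := (β ^ j)⁻¹ with hx
  -- Trace words belong to the code: at a zero `β ^ t` each conjugate contributes a geometric sum
  -- over an `n`-th root of unity different from 1.
  have hmem : ∀ θ : K, (fun i : Fin n => Algebra.trace F K (θ * x ^ (i : ℕ))) ∈
      polyCode lam n g := by
    intro θ
    rw [S.mem_polyCode_iff hg]
    intro t ht
    simp only [FiniteField.algebraMap_trace_eq_sum_pow, S.card_eq, S.finrank_eq, Finset.sum_mul]
    rw [Finset.sum_comm]
    refine Finset.sum_eq_zero fun k hk => ?_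
    have h1 : ∀ i : Fin n, (θ * x ^ (i : ℕ)) ^ q ^ k * (β ^ t) ^ (i : ℕ) =
        θ ^ q ^ k * (x ^ q ^ k * β ^ t) ^ (i : ℕ) := fun i => by
      rw [mul_pow, mul_pow, ← pow_mul, ← pow_mul x, mul_comm (i : ℕ), mul_assoc]
    have h2 : (x ^ q ^ k * β ^ t) ^ n = 1 := by
      rw [mul_pow, S.pow_pow_length (modEq_one_of_mem_weightSet S.two_lt ht), ← pow_mul,
        mul_comm (q ^ k), pow_mul, hx, inv_pow, S.pow_pow_length hj1, inv_pow, ← map_pow,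
        S.algebraMap_pow]
      exact inv_mul_cancel₀ (by simpa using S.lam_ne_zero)
    have h3 := S.pow_mul_pow_ne_one hj hjT ht (Finset.mem_range.mp hk).le
    have h4 : ∑ i : Fin n, (x ^ q ^ k * β ^ t) ^ (i : ℕ) = 0 := by
      rw [Fin.sum_univ_eq_sum_range (fun i => (x ^ q ^ k * β ^ t) ^ i) n]
      have := geom_sum_mul (x ^ q ^ k * β ^ t) n
      rw [h2, sub_self] at this
      exact (mul_eq_zero.mp this).resolve_right (sub_ne_zero.mpr h3)
    rw [Finset.sum_congr rfl fun i _ => h1 i, ← Finset.mul_sum, h4, mul_zero]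
  -- Orthogonality to all trace words says that the sum has trace zero against every `θ`.
  refine (traceForm_nondegenerate F K).1 _ fun θ => ?_
  rw [Algebra.traceForm_apply, Finset.sum_mul, map_sum, ← ha _ (hmem θ)]
  refine Finset.sum_congr rfl fun i _ => ?_
  rw [mul_assoc, ← Algebra.smul_def, map_smul, smul_eq_mul, mul_comm θ]

/-! ### Bounds for the minimum distance -/

/-- `gcd (q ^ m - 1, q ^ a - 1) = q ^ gcd (m, a) - 1 = q - 1`, so the base has order exactly `n`. -/
lemma injective_pow (S : Setting q m n lam β) {a : ℕ} (ha : Nat.gcd m a = 1) :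
    Function.Injective fun j : Fin n => (β ^ (q ^ a - 1)) ^ (j : ℕ) := by
  intro i j h
  simp only [← pow_mul] at h
  have h1 := (S.pow_eq_pow_iff.mp h).cancel_left_div_gcd (by have := S.one_lt_pow; omega)
  rw [Nat.pow_sub_one_gcd_pow_sub_one, ha, pow_one, ← S.mul_eq,
    Nat.mul_div_cancel_left _ (by have := S.two_lt; omega)] at h1
  exact Fin.ext (h1.eq_of_lt_of_lt i.2 j.2)

variable [DecidableEq F]

lemma lt_minDist_polyCode (S : Setting q m n lam β)
    (hg : g.map (algebraMap F K) = rootPoly β q m l) {a x N : ℕ} (ha : Nat.gcd m a = 1)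
    (h : ∀ i < N, x + i * (q ^ a - 1) ∈ weightSet q m l) :
    N + 1 ≤ minDist (polyCode lam n g) := by
  refine le_minDist (S.polyCode_ne_bot hg) fun c hc hc0 => ?_
  refine lt_hammingNorm (pow_ne_zero x S.ne_zero) (S.injective_pow ha) hc0 fun i hi => ?_
  have := (S.mem_polyCode_iff hg).mp hc _ (h i hi)
  rwa [pow_add, mul_comm i, pow_mul] at this

lemma lt_minDist_dualCode (S : Setting q m n lam β) (hl : l < m)
    (hg : g.map (algebraMap F K) = rootPoly β q m l) {x N : ℕ} (hx : x ≡ 1 [MOD (q - 1)])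
    (h : ∀ i < N, (x + (q - 1) * i) % (q ^ m - 1) ∉ weightSet q m l) :
    N + 1 ≤ minDist (dualCode (polyCode lam n g)) := by
  refine le_minDist (S.dualCode_ne_bot hl hg) fun c hc hc0 => ?_
  have hinj : Function.Injective fun j : Fin n => (β ^ (q - 1))⁻¹ ^ (j : ℕ) := fun i j hij =>
    S.injective_pow (a := 1) (by simp) (by simpa using hij)
  refine lt_hammingNorm (inv_ne_zero (pow_ne_zero x S.ne_zero)) hinj hc0 fun i hi => ?_
  have hmod : (x + (q - 1) * i) % (q ^ m - 1) ≡ 1 [MOD (q - 1)] := by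
    refine ((Nat.mod_modEq _ _).of_dvd ⟨n, S.mul_eq.symm⟩).trans (Nat.ModEq.trans ?_ hx)
    simp [Nat.ModEq]
  have := S.sum_eq_zero_of_mem_dualCode hg hc
    (Nat.mod_lt _ (by have := S.one_lt_pow; omega)) hmod (h i hi)
  rwa [S.pow_mod, pow_add, pow_mul, mul_inv, ← inv_pow (β ^ (q - 1))] at this

end Setting

/-! ### Arithmetic progressions of prescribed weight -/

lemma add_pow_mul_lt {q a b x y : ℕ} (hx : x < q ^ a) (hy : y < q ^ b) :
    x + q ^ a * y < q ^ (a + b) := by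
  calc x + q ^ a * y < q ^ a * (y + 1) := by rw [mul_add]; omega
    _ ≤ q ^ a * q ^ b := Nat.mul_le_mul_left _ hy
    _ = q ^ (a + b) := (pow_add q a b).symm

lemma two_mul_pow_lt {q a b : ℕ} (hq : 2 < q) (h : a < b) : 2 * q ^ a < q ^ b := by
  have h1 : q ^ (a + 1) ≤ q ^ b := Nat.pow_le_pow_right (by omega) h
  have h2 : 3 * q ^ a ≤ q ^ (a + 1) := by rw [pow_succ']; gcongr; omega
  have : 0 < q ^ a := by positivity
  omega

/-- Exhibits the low block `N - 1 - i` and the high block `i`, which always add up to `N - 1`. -/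
lemma progression_eq {q a N i x : ℕ} (hq : 0 < q) (hi : i < N) :
    N - 1 + x + i * (q ^ a - 1) = N - 1 - i + q ^ a * i + x := by
  have h1 : i * (q ^ a - 1) + i = q ^ a * i := by
    rw [Nat.mul_sub, mul_one, mul_comm (q ^ a),
      Nat.sub_add_cancel (Nat.le_mul_of_pos_right _ (by positivity))]
  omega

/-- Two complementary blocks for `N = 2 * q ^ l` have total weight `(q - 1) * l + 1`. -/
lemma progression_two_mul_pow {q m a l i : ℕ} (hq : 2 < q) (hla : l < a) (ham : 2 * a < m)
    (hi : i < 2 * q ^ l) : 2 * q ^ l - 1 + i * (q ^ a - 1) ∈ weightSet q m l := by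
  have hlt := two_mul_pow_lt hq hla
  rw [← add_zero (2 * q ^ l - 1), progression_eq (by omega) hi, add_zero]
  refine mem_weightSet_of_lt hq (by omega) ?_ ?_
  · calc _ < q ^ (a + a) := add_pow_mul_lt (by omega) (by omega)
      _ ≤ q ^ m := Nat.pow_le_pow_right (by omega) (by omega)
  · rw [qWeight_add_pow_mul _ (by omega) (by omega)]
    have := qWeight_add_qWeight_sub (r := l) (t := 2) (by omega) (by omega) hi
    omega

/-- Complementary blocks of full length `a` contribute `(q - 1) * a`; the constant top block `2 * q
^ k - 1` supplies the remaining `1 + (q - 1) * k`. -/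
lemma progression_pow {q m a k i : ℕ} (hq : 2 < q) (ham : 2 * a + k < m) (hi : i < q ^ a) :
    q ^ a - 1 + q ^ (a + a) * (2 * q ^ k - 1) + i * (q ^ a - 1) ∈ weightSet q m (a + k) := by
  have hpos : 0 < q ^ a := by positivity
  have hlt : q ^ a - 1 - i + q ^ a * i < q ^ (a + a) := add_pow_mul_lt (by omega) hi
  have hlt' := two_mul_pow_lt hq (show k < m - (a + a) by omega)
  rw [progression_eq (by omega) hi]
  refine mem_weightSet_of_lt hq (by omega) ?_ ?_
  · calc _ < q ^ (a + a + (m - (a + a))) := add_pow_mul_lt hlt (by omega)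
      _ = q ^ m := by rw [Nat.add_sub_cancel' (by omega)]
  · rw [qWeight_add_pow_mul _ (by omega) hlt, qWeight_add_pow_mul _ (by omega) (by omega),
      qWeight_two_mul_pow_sub_one (by omega)]
    have := qWeight_add_qWeight_compl (by omega) hi
    rw [mul_add]
    omega

/-- For large weight, complement all `m` digits: blocks for `N = (q - 1) * q ^ r` have total weight
`(q - 1) * r + (q - 2)`, leaving `1 + (q - 1) * (m - 1 - r)`. -/
lemma progression_compl {q m a r i : ℕ} (hq : 2 < q) (hra : r < a) (ham : 2 * a < m)
    (hi : i < (q - 1) * q ^ r) :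
    q ^ m - 1 - q ^ a * ((q - 1) * q ^ r - 1) + i * (q ^ a - 1) ∈ weightSet q m (m - 1 - r) := by
  have hpos : 0 < q ^ a := by positivity
  set N := (q - 1) * q ^ r with hN
  have hlt : N < q ^ a := by
    calc N < q * q ^ r := Nat.mul_lt_mul_of_pos_right (by omega) (by positivity)
      _ = q ^ (r + 1) := (pow_succ' q r).symm
      _ ≤ q ^ a := Nat.pow_le_pow_right (by omega) hra
  have hlt2 : ∀ j k, j < N → k < N → j + q ^ a * k < q ^ m := fun j k hj hk =>
    calc _ < q ^ (a + a) := add_pow_mul_lt (by omega) (by omega)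
      _ ≤ q ^ m := Nat.pow_le_pow_right (by omega) (by omega)
  have heq : q ^ m - 1 - q ^ a * (N - 1) + i * (q ^ a - 1) =
      q ^ m - 1 - (i + q ^ a * (N - 1 - i)) := by
    have h1 := hlt2 i (N - 1 - i) hi (by omega)
    have h2 := hlt2 0 (N - 1) (by omega) (by omega)
    have h3 : q ^ a * (N - 1) = q ^ a * (N - 1 - i) + q ^ a * i := by
      rw [← mul_add]; congr 1; omega
    have h4 : i * (q ^ a - 1) + i = q ^ a * i := by
      rw [Nat.mul_sub, mul_one, mul_comm (q ^ a),
        Nat.sub_add_cancel (Nat.le_mul_of_pos_right _ hpos)]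
    omega
  rw [heq]
  refine mem_weightSet_of_lt hq (by omega) ?_ ?_
  · have : 0 < q ^ m := by positivity
    omega
  · have h1 := qWeight_add_qWeight_compl (by omega) (hlt2 i (N - 1 - i) hi (by omega))
    rw [qWeight_add_pow_mul _ (by omega) (by omega)] at h1
    have h2 := qWeight_add_qWeight_sub (r := r) (t := q - 1) (by omega) (by omega) hi
    rw [← hN] at h2
    obtain ⟨s, rfl⟩ := Nat.exists_eq_add_of_lt (show r < m by omega)
    have h3 : (q - 1) * (r + s + 1) = (q - 1) * r + (q - 1) * s + (q - 1) := by ring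
    rw [show r + s + 1 - 1 - r = s by omega]
    omega

/-- A run of exponents outside the weight set, which are zeros of the dual code. -/
lemma progression_notMem {q m l s i : ℕ} (hq : 2 < q) (hl : l < m) (hs : (q - 1) * s = q ^ l - 1)
    (hi : i < q ^ (m - 1 - l) - 1 + 2 * s) :
    (q ^ m - (q - 1) * (q ^ (m - 1 - l) - 1) + (q - 1) * i) % (q ^ m - 1) ∉
      weightSet q m l := by
  obtain ⟨r, rfl⟩ := Nat.exists_eq_add_of_lt hl
  rw [show l + r + 1 - 1 - l = r by omega] at *
  have hposr : 0 < q ^ r := by positivity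
  have hposl : 0 < q ^ l := by positivity
  have hpow : q ^ (l + r + 1) = q * q ^ (l + r) := pow_succ' q _
  have hler : q ^ r ≤ q ^ (l + r) := Nat.pow_le_pow_right (by omega) (by omega)
  have hlel : q ^ l ≤ q ^ (l + r) := Nat.pow_le_pow_right (by omega) (by omega)
  have h3 : 3 * q ^ (l + r) ≤ q * q ^ (l + r) := Nat.mul_le_mul_right _ (by omega)
  have hqr : (q - 1) * q ^ r + q ^ (l + r) ≤ q ^ (l + r + 1) := by
    have : (q - 1) * q ^ (l + r) + q ^ (l + r) = q * q ^ (l + r) := by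
      rw [← Nat.succ_mul]; congr 1; omega
    have := Nat.mul_le_mul_left (q - 1) hler
    omega
  -- Before the wrap-around the digit complement is too small to have the complementary weight;
  -- after it the exponent is below `2 * q ^ l - 1`, the least number of weight `1 + (q - 1) * l`.
  rcases lt_or_ge i (q ^ r - 1) with h | h
  · obtain ⟨e, he⟩ : ∃ e, q ^ r = i + e + 2 := ⟨q ^ r - i - 2, by omega⟩
    have h1 : (q - 1) * (q ^ r - 1) = (q - 1) * i + (q - 1) * e + (q - 1) := by
      rw [he, show i + e + 2 - 1 = i + e + 1 by omega]; ring
    have h2 : (q - 1) * q ^ r = (q - 1) * (q ^ r - 1) + (q - 1) := by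
      rw [← Nat.mul_succ]; congr 1; omega
    have h4 : q ^ (l + r + 1) - (q - 1) * (q ^ r - 1) + (q - 1) * i =
        q ^ (l + r + 1) - 1 - ((q - 1) * e + (q - 2)) := by omega
    rw [h4, Nat.mod_eq_of_lt (by omega)]
    intro hmem
    have h5 := (mem_weightSet.mp hmem).2
    have h6 := qWeight_add_qWeight_compl (q := q) (k := l + r + 1)
      (x := (q - 1) * e + (q - 2)) (by omega) (by omega)
    have h7 : qWeight q ((q - 1) * e + (q - 2)) < (q - 1) * r + (q - 2) := by
      refine qWeight_lt (by omega) (by omega) ?_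
      rw [show q - 2 + 1 = q - 1 by omega]
      omega
    have h8 : (q - 1) * (l + r + 1) = (q - 1) * l + (q - 1) * r + (q - 1) := by ring
    omega
  · obtain ⟨e, rfl⟩ := Nat.exists_eq_add_of_le h
    have h1 : (q - 1) * e + (q - 1) ≤ 2 * (q ^ l - 1) := by
      rw [← hs, ← Nat.mul_succ, mul_left_comm]
      exact Nat.mul_le_mul_left _ (by omega)
    have h2 : (q - 1) * q ^ r = (q - 1) * (q ^ r - 1) + (q - 1) := by
      rw [← Nat.mul_succ]; congr 1; omega
    have h4 : q ^ (l + r + 1) - (q - 1) * (q ^ r - 1) + (q - 1) * (q ^ r - 1 + e) =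
        (q ^ (l + r + 1) - 1) + (1 + (q - 1) * e) := by
      rw [mul_add]; omega
    rw [h4, Nat.add_mod_left, Nat.mod_eq_of_lt (by omega)]
    intro hmem
    have h5 := (mem_weightSet.mp hmem).2
    have h6 : qWeight q (1 + (q - 1) * e) < (q - 1) * l + 1 :=
      qWeight_lt (by omega) (by omega) (by omega)
    omega

/-! ### Step exponents coprime to `m` -/

/-- Used with `d = m - 2 * a`, which is 1, 2 or 4; in the even cases `a` is odd. -/
lemma gcd_eq_one_of_dvd {a m d : ℕ} (h1 : Nat.gcd m a ∣ d) (h2 : Nat.Coprime a d) :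
    Nat.gcd m a = 1 :=
  Nat.eq_one_of_dvd_coprimes h2 (Nat.gcd_dvd_right _ _) h1

lemma gcd_sub_one_div_two {m : ℕ} (h : m % 2 = 1) : Nat.gcd m ((m - 1) / 2) = 1 := by
  refine gcd_eq_one_of_dvd (d := 1) ?_ (Nat.coprime_one_right _)
  have := Nat.dvd_sub (Nat.gcd_dvd_left m ((m - 1) / 2))
    ((Nat.gcd_dvd_right m ((m - 1) / 2)).mul_left 2)
  rwa [show m - 2 * ((m - 1) / 2) = 1 by omega] at this

lemma gcd_div_two_sub_one {m : ℕ} (h : m % 4 = 0) (hm : 2 ≤ m) : Nat.gcd m (m / 2 - 1) = 1 := by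
  refine gcd_eq_one_of_dvd (d := 2) ?_ ?_
  · have := Nat.dvd_sub (Nat.gcd_dvd_left m (m / 2 - 1))
      ((Nat.gcd_dvd_right m (m / 2 - 1)).mul_left 2)
    rwa [show m - 2 * (m / 2 - 1) = 2 by omega] at this
  · exact Nat.coprime_two_right.mpr (Nat.odd_iff.mpr (by omega))

lemma gcd_div_two_sub_two {m : ℕ} (h : m % 4 = 2) (hm : 6 ≤ m) : Nat.gcd m (m / 2 - 2) = 1 := by
  refine gcd_eq_one_of_dvd (d := 4) ?_ ?_
  · have := Nat.dvd_sub (Nat.gcd_dvd_left m (m / 2 - 2))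
      ((Nat.gcd_dvd_right m (m / 2 - 2)).mul_left 2)
    rwa [show m - 2 * (m / 2 - 2) = 4 by omega] at this
  · exact (Nat.coprime_two_right.mpr (Nat.odd_iff.mpr (by omega)) : Nat.Coprime _ 2).pow_right 2

/-! ### Assembling the distance bounds -/

namespace Setting

variable {F K : Type*} [Field F] [DecidableEq F] [Field K] [Algebra F K] {q m n l : ℕ} {lam : F}
  {β : K} {g : F[X]}

lemma two_le_minDist (S : Setting q m n lam β) (hl : l < m)
    (hg : g.map (algebraMap F K) = rootPoly β q m l) : 2 ≤ minDist (polyCode lam n g) := by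
  refine S.lt_minDist_polyCode hg (a := 1) (x := 2 * q ^ l - 1) (by simp) fun i hi => ?_
  simpa [show i = 0 by omega] using two_mul_pow_sub_one_mem_weightSet S.two_lt hl

lemma minDist_ge_of_lt (S : Setting q m n lam β)
    (hg : g.map (algebraMap F K) = rootPoly β q m l) {a : ℕ} (ha : Nat.gcd m a = 1)
    (hla : l < a) (ham : 2 * a < m) :
    2 * (q : ℚ) ^ l + 1 ≤ minDist (polyCode lam n g) := by
  exact_mod_cast S.lt_minDist_polyCode hg ha fun i hi =>
    progression_two_mul_pow S.two_lt hla ham hi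

lemma minDist_ge_of_le (S : Setting q m n lam β)
    (hg : g.map (algebraMap F K) = rootPoly β q m l) {a : ℕ} (ha : Nat.gcd m a = 1)
    (hla : a ≤ l) (ham : a + l < m) :
    (q : ℚ) ^ a + 1 ≤ minDist (polyCode lam n g) := by
  obtain ⟨k, rfl⟩ := Nat.exists_eq_add_of_le hla
  exact_mod_cast S.lt_minDist_polyCode hg ha fun i hi =>
    progression_pow S.two_lt (by omega) hi

lemma minDist_ge_of_compl (S : Setting q m n lam β) (hl : l < m)
    (hg : g.map (algebraMap F K) = rootPoly β q m l) {a : ℕ} (ha : Nat.gcd m a = 1)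
    (hla : m - 1 - l < a) (ham : 2 * a < m) :
    ((q : ℚ) - 1) * (q : ℚ) ^ ((m : ℤ) - 1 - l) + 1 ≤ minDist (polyCode lam n g) := by
  have h := S.lt_minDist_polyCode hg ha fun i hi => by
    have := progression_compl S.two_lt hla ham hi
    rwa [show m - 1 - (m - 1 - l) = l by omega] at this
  have hcast : (m : ℤ) - 1 - l = ((m - 1 - l : ℕ) : ℤ) := by omega
  rw [hcast, zpow_natCast]
  have h1 : ((q - 1 : ℕ) : ℚ) = (q : ℚ) - 1 := by
    rw [Nat.cast_sub (by have := S.two_lt; omega), Nat.cast_one]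
  rw [← h1]
  exact_mod_cast h

lemma distBound_le (S : Setting q m n lam β) (hl : l < m)
    (hg : g.map (algebraMap F K) = rootPoly β q m l) :
    distBound q m l ≤ minDist (polyCode lam n g) := by
  have hm := S.two_le
  -- The rational case conditions become integer inequalities, so that `omega` can decide them.
  have hhalf : ∀ (x y : ℤ), (x : ℚ) ≤ (y : ℚ) / 2 ↔ 2 * x ≤ y := fun x y => by
    rw [le_div_iff₀ two_pos, mul_comm]; exact_mod_cast Iff.rfl
  have hhalf' : ∀ (x y : ℤ), (y : ℚ) / 2 ≤ (x : ℚ) ↔ y ≤ 2 * x := fun x y => by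
    rw [div_le_iff₀ two_pos, mul_comm]; exact_mod_cast Iff.rfl
  have hhalf'' : ∀ (x y : ℤ), (x : ℚ) = (y : ℚ) / 2 ↔ 2 * x = y := fun x y => by
    rw [eq_div_iff two_ne_zero, mul_comm]; exact_mod_cast Iff.rfl
  have e1 := hhalf l (m - 3)
  have e2 := hhalf l (m - 4)
  have e3 := hhalf l (m - 6)
  have e4 := hhalf' l (m - 4)
  have e5 := hhalf l (m + 2)
  have e6 := hhalf'' l (m - 2)
  have e7 := hhalf'' l m
  have e8 := hhalf'' l (m - 1)
  push_cast at e1 e2 e3 e4 e5 e6 e7 e8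
  simp only [distBound, e1, e2, e3, e4, e5, e6, e7, e8]
  have hzpow : ∀ (z : ℤ) (a : ℕ), z = a → (q : ℚ) ^ z = (q : ℚ) ^ a := fun z a h => by
    rw [h, zpow_natCast]
  split_ifs with h1 h2 h3 h4
  · rcases h1 with h | h | h
    · exact S.minDist_ge_of_lt hg (gcd_sub_one_div_two h.1) (by omega) (by omega)
    · exact S.minDist_ge_of_lt hg (gcd_div_two_sub_one h.1 hm) (by omega) (by omega)
    · exact S.minDist_ge_of_lt hg (gcd_div_two_sub_two h.1 (by omega)) (by omega) (by omega)
  · rcases Nat.lt_or_ge m 6 with hm6 | hm6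
    · obtain rfl : m = 2 := by omega
      have h := S.two_le_minDist hl hg
      have hq : (1 : ℚ) ≤ q := by
        have := S.two_lt
        exact_mod_cast (by omega : 1 ≤ q)
      calc (q : ℚ) ^ ((((2 : ℕ) : ℤ) - 4) / 2) + 1 ≤ 1 + 1 := by
            gcongr
            exact zpow_le_one_of_nonpos₀ hq (by norm_num)
        _ = ((2 : ℕ) : ℚ) := by norm_num
        _ ≤ _ := by exact_mod_cast h
    · rw [hzpow _ (m / 2 - 2) (by omega)]
      exact S.minDist_ge_of_le hg (gcd_div_two_sub_two h2.1 hm6) (by omega) (by omega)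
  · rw [hzpow _ (m / 2 - 1) (by omega)]
    exact S.minDist_ge_of_le hg (gcd_div_two_sub_one h3.1 hm) (by omega) (by omega)
  · rw [hzpow _ ((m - 1) / 2) (by omega)]
    exact S.minDist_ge_of_le hg (gcd_sub_one_div_two h4.1) (by omega) (by omega)
  · obtain h | h | h : m % 2 = 1 ∨ m % 4 = 0 ∨ m % 4 = 2 := by omega
    · exact S.minDist_ge_of_compl hl hg (gcd_sub_one_div_two h) (by omega) (by omega)
    · exact S.minDist_ge_of_compl hl hg (gcd_div_two_sub_one h hm) (by omega) (by omega)
    · exact S.minDist_ge_of_compl hl hg (gcd_div_two_sub_two h (by omega)) (by omega) (by omega)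

lemma dualDistBound_le (S : Setting q m n lam β) (hl : l < m)
    (hg : g.map (algebraMap F K) = rootPoly β q m l) :
    dualDistBound q m l ≤ minDist (dualCode (polyCode lam n g)) := by
  have hq := S.two_lt
  obtain ⟨s, hs⟩ : q - 1 ∣ q ^ l - 1 := by simpa using Nat.sub_dvd_pow_sub_pow q 1 l
  have hpos : 0 < q ^ (m - 1 - l) := by positivity
  have hle : (q - 1) * (q ^ (m - 1 - l) - 1) < q ^ m := by
    calc (q - 1) * (q ^ (m - 1 - l) - 1) < q * q ^ (m - 1 - l) :=
          Nat.mul_lt_mul'' (by omega) (by omega)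
      _ = q ^ (m - 1 - l + 1) := (pow_succ' q _).symm
      _ ≤ q ^ m := Nat.pow_le_pow_right (by omega) (by omega)
  have hmod : q ^ m - (q - 1) * (q ^ (m - 1 - l) - 1) ≡ 1 [MOD (q - 1)] := by
    refine ((Nat.modEq_iff_dvd' (by omega)).mpr ?_).symm
    rw [Nat.sub_right_comm, ← S.mul_eq]
    exact Nat.dvd_sub (dvd_mul_right _ _) (dvd_mul_right _ _)
  have h := S.lt_minDist_dualCode hl hg hmod fun i hi =>
    progression_notMem hq hl hs.symm hi
  have hcast : (m : ℤ) - 1 - l = ((m - 1 - l : ℕ) : ℤ) := by omega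
  have hq1 : (q : ℚ) - 1 ≠ 0 := by
    have : (2 : ℚ) < q := by exact_mod_cast hq
    linarith
  have hs' : (q : ℚ) ^ l - 1 = ((q : ℚ) - 1) * s := by
    have h1 : ((q ^ l - 1 : ℕ) : ℚ) = ((q - 1) * s : ℕ) := by rw [hs]
    rwa [Nat.cast_sub (Nat.one_le_pow _ _ (by omega)), Nat.cast_mul, Nat.cast_sub (by omega),
      Nat.cast_pow, Nat.cast_one] at h1
  rw [dualDistBound, hcast, zpow_natCast, hs', mul_left_comm, mul_div_cancel_left₀ _ hq1]
  rw [show q ^ (m - 1 - l) - 1 + 2 * s + 1 = q ^ (m - 1 - l) + 2 * s by omega] at h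
  exact_mod_cast h

end Setting

end ConstaCode

theorem mainTheorem4 {F K : Type*} [Field F] [DecidableEq F] [Field K] [Algebra F K]
    (q m l n : ℕ) (hq : 2 < q) (hm : 2 ≤ m) (hl : l ≤ m - 1)
    (hn : n = (q ^ m - 1) / (q - 1))
    (hF : Nat.card F = q) (hK : Module.finrank F K = m)
    (lam : F) (hlam : IsPrimitiveRoot lam (q - 1))
    (β : K) (hβ : IsPrimitiveRoot β (q ^ m - 1)) (hβlam : β ^ n = algebraMap F K lam) :
    ∃ g : Polynomial F,
      g.map (algebraMap F K) = ConstaCode.rootPoly β q m l ∧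
      g ∣ Polynomial.X ^ n - Polynomial.C lam ∧
      {i ∈ ConstaCode.rootExponents q m | Polynomial.aeval (β ^ i) g = 0} =
        {i | i ∈ ConstaCode.weightSet q m l} ∧
      ConstaCode.IsConstacyclic lam (ConstaCode.polyCode lam n g) ∧
      (Module.finrank F (ConstaCode.polyCode lam n g) : ℤ) =
        n - ConstaCode.binomSum q m l ∧
      ConstaCode.distBound q m l ≤ ConstaCode.minDist (ConstaCode.polyCode lam n g) ∧
      ConstaCode.IsConstacyclic lam⁻¹ (ConstaCode.dualCode (ConstaCode.polyCode lam n g)) ∧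
      (Module.finrank F (ConstaCode.dualCode (ConstaCode.polyCode lam n g)) : ℤ) =
        ConstaCode.binomSum q m l ∧
      ConstaCode.dualDistBound q m l ≤
        ConstaCode.minDist (ConstaCode.dualCode (ConstaCode.polyCode lam n g)) := by
  have hl' : l < m := by omega
  have S : ConstaCode.Setting q m n lam β :=
    { two_lt := hq
      two_le := hm
      mul_eq := by
        rw [hn]
        exact Nat.mul_div_cancel' (by simpa using Nat.sub_dvd_pow_sub_pow q 1 m)
      card_eq := hF
      finrank_eq := hK
      primitive := hβ
      pow_eq := hβlam }
  obtain ⟨g, hg⟩ := S.exists_map_eq_rootPoly l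
  have hcard := ConstaCode.card_weightSet hq hl'
  have hdim := S.finrank_polyCode_add hg
  refine ⟨g, hg, S.dvd_X_pow_sub_C hg, S.rootExponents_inter hg, S.isConstacyclic hg, ?_,
    S.distBound_le hl' hg, S.isConstacyclic_dualCode hg, ?_, S.dualDistBound_le hl' hg⟩
  · omega
  · rw [S.finrank_dualCode_eq hg, hcard]
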